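/- Let $F$ be a field (of any characteristic), let $W$ be an $F$-vector space of finite even dimension $2m$, and let $Q_W$ be a quadratic form on $W$ which is non-singular, i.e. its polar form $f_W(u,v)=Q_W(u+v)-Q_W(u)-Q_W(v)$ is non-degenerate. Let $\mathrm{GO}_{2m}(F,Q_W)$ be the group of invertible linear transformations of $W$ preserving $Q_W$, let $\mathrm{SO}_{2m}(F,Q_W)$ be its subgroup of elements of determinant $1$ if $\operatorname{char}F\neq 2$, and its subgroup of elements $g$ with $\dim_F\operatorname{Im}(1-g)$ even if $\operatorname{char}F=2$. Let $\Omega_{2m}(F,Q_W)$ be the kernel of the spinor norm $\mathrm{SO}_{2m}(F,Q_W)\to F^\times/(F^\times)^2$; here, if $g$ is induced by conjugation with an invertible even element $x$ of the Clifford algebra of $Q_W$, i.e. $xvx^{-1}=g(v)$ for all $v\in W$, the spinor norm of $g$ is the class of the scalar $x^{t}x$, where $x\mapsto x^t$ is the anti-automorphism of the Clifford algebra fixing $W$ pointwise. Let $W{:}\Omega_{2m}(F,Q_W)$ be the semidirect product for the natural action of $\Omega_{2m}(F,Q_W)$ on the additive group of $W$. Suppose that the Witt index of $Q_W$ (the largest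 dimension of a subspace of $W$ on which $Q_W$ vanishes identically) is at least $2$. Then $\Omega_{2m}(F,Q_W)$ is a maximal subgroup of $W{:}\Omega_{2m}(F,Q_W)$. Moreover, the affine action of $W{:}\Omega_{2m}(F,Q_W)$ on $W$, in which $(v,A)$ acts as $u\mapsto Au+v$, is primitive. -/

import Mathlib

namespace Orth

/-- An alternating bilinear form has even rank. -/
theorem even_finrank_of_alternating {F : Type*} [Field F] (n : ℕ) :
    ∀ {M : Type*} [AddCommGroup M] [Module F M] [FiniteDimensional F M]
      (a : M →ₗ[F] M →ₗ[F] F), (∀ m, a m m = 0) → Module.finrank F M = n →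
      Even (Module.finrank F M + Module.finrank F (LinearMap.ker a)) := by
  induction n using Nat.strong_induction_on with
  | _ n ih =>
    intro M _ _ _ a ha hn
    have hskew : ∀ x y, a x y = - a y x := by
      intro x y
      have h := ha (x + y)
      simp only [map_add, LinearMap.add_apply, ha, zero_add, add_zero] at h
      exact eq_neg_of_add_eq_zero_right h
    by_cases h0 : a = 0
    · subst h0
      rw [LinearMap.ker_zero, finrank_top]
      exact Even.add_self _
    · obtain ⟨x, y, hxy⟩ : ∃ x y, a x y ≠ 0 := by
        by_contra! h
        exact h0 (LinearMap.ext fun x => LinearMap.ext fun y => h x y)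
      set p : M →ₗ[F] F × F := (a x).prod (a y) with hp
      have hs : Function.Surjective p := by
        rintro ⟨s, t⟩
        refine ⟨(-(t / a x y)) • x + (s / a x y) • y, ?_⟩
        ext
        · simp [hp, ha, hxy]
        · simp [hp, ha, hskew y x, hxy]
      have hr := LinearMap.finrank_range_add_finrank_ker p
      rw [LinearMap.range_eq_top.mpr hs, finrank_top, Module.finrank_prod,
        Module.finrank_self] at hr
      set N := LinearMap.ker p with hN
      have hmemN : ∀ m, m ∈ N ↔ a x m = 0 ∧ a y m = 0 := by
        intro m
        simp [hN, hp]
      let b : N →ₗ[F] N →ₗ[F] F := (a.domRestrict₁₂ N N)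
      have hb : ∀ m m', b m m' = a m m' := fun m m' => rfl
      have hker : LinearMap.ker b = (LinearMap.ker a).comap N.subtype := by
        ext ⟨m, hm⟩
        simp only [LinearMap.mem_ker, Submodule.mem_comap, Submodule.subtype_apply]
        constructor
        · intro h
          ext w
          have h1 : a m x = 0 := by rw [hskew, ((hmemN m).1 hm).1, neg_zero]
          have h2 : a m y = 0 := by rw [hskew, ((hmemN m).1 hm).2, neg_zero]
          set w' := w - ((-(a y w / a x y)) • x + (a x w / a x y) • y) with hw'
          have hw'N : w' ∈ N := by
            rw [hmemN]
            constructor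
            · simp [hw', ha, hxy]
            · simp [hw', ha, hskew y x, hxy]
          have h3 : a m w' = 0 := by
            have := LinearMap.congr_fun h ⟨w', hw'N⟩
            simpa [hb] using this
          simpa [hw', h1, h2] using h3
        · intro h
          ext w
          simp [hb, h]
      have hle : LinearMap.ker a ≤ N := by
        intro m hm
        rw [hmemN, hskew, hskew y]
        simp [LinearMap.mem_ker.1 hm]
      have h1 := ih (Module.finrank F N) (by omega) b (fun m => ha m) rfl
      rw [hker, (Submodule.comapSubtypeEquivOfLe hle).finrank_eq] at h1
      rw [← hr]
      have : 1 + 1 + Module.finrank F N + Module.finrank F (LinearMap.ker a) =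
        2 + (Module.finrank F N + Module.finrank F (LinearMap.ker a)) := by ring
      rw [this]
      exact even_two.add h1

/-- The group `GO(V, Q)` of invertible linear maps `V → V` that preserve `Q`. -/
def GO {F V : Type*} [Field F] [AddCommGroup V] [Module F V] (Q : QuadraticForm F V) :
    Subgroup (V ≃ₗ[F] V) where
  carrier := {g | ∀ v, Q (g v) = Q v}
  mul_mem' {g h} hg hh v := by rw [LinearEquiv.mul_apply, hg, hh]
  one_mem' _ := rfl
  inv_mem' {g} hg v := by
    rw [← hg (g⁻¹ v), ← LinearEquiv.mul_apply, mul_inv_cancel]; rfl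

/-- The quasideterminant `dim Im (1 - g) mod 2`. -/
noncomputable def qdet {F V : Type*} [Field F] [AddCommGroup V] [Module F V]
    (g : V ≃ₗ[F] V) : ZMod 2 :=
  (Module.finrank F (LinearMap.range (LinearMap.id - (g : V →ₗ[F] V))) : ZMod 2)

theorem GO.polar_map {F V : Type*} [Field F] [AddCommGroup V] [Module F V]
    {Q : QuadraticForm F V} {g : V ≃ₗ[F] V} (hg : g ∈ GO Q) (u v : V) :
    Q.polarBilin (g u) (g v) = Q.polarBilin u v := by
  have hg' : ∀ v, Q (g v) = Q v := hg
  simp only [QuadraticMap.polarBilin_apply_apply, QuadraticMap.polar, ← map_add, hg']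

theorem GO.orthogonal_fixed {F V : Type*} [Field F] [AddCommGroup V] [Module F V]
    [FiniteDimensional F V] {Q : QuadraticForm F V} (hQ : Q.polarBilin.Nondegenerate)
    {g : V ≃ₗ[F] V} (hg : g ∈ GO Q) :
    LinearMap.BilinForm.orthogonal Q.polarBilin
        (LinearMap.range (LinearMap.id - (g : V →ₗ[F] V))) =
      LinearMap.ker (LinearMap.id - (g : V →ₗ[F] V)) := by
  ext x
  rw [LinearMap.BilinForm.mem_orthogonal_iff, LinearMap.mem_ker, LinearMap.sub_apply,
    LinearMap.id_apply, LinearEquiv.coe_coe]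
  have key : ∀ y, Q.polarBilin ((LinearMap.id - (g : V →ₗ[F] V) : V →ₗ[F] V) y) x
      = Q.polarBilin (g y) (g x - x) := by
    intro y
    simp [-QuadraticMap.polarBilin_apply_apply, GO.polar_map hg]
  constructor
  · intro h
    have h2 : ∀ z, Q.polarBilin z (g x - x) = 0 := by
      intro z
      have := h _ ⟨g.symm z, rfl⟩
      rwa [key, LinearEquiv.apply_symm_apply] at this
    have := hQ.2 _ h2
    rw [← neg_sub, this, neg_zero]
  · rintro h _ ⟨y, rfl⟩
    rw [key, ← neg_sub, h, neg_zero, map_zero]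

/-- If the polar form of `Q` is nondegenerate, the quasideterminant is a homomorphism on
`GO(V, Q)`. -/
theorem qdet_mul {F V : Type*} [Field F] [AddCommGroup V] [Module F V]
    [FiniteDimensional F V] {Q : QuadraticForm F V} (hQ : Q.polarBilin.Nondegenerate)
    {g h : V ≃ₗ[F] V} (hg : g ∈ GO Q) (hh : h ∈ GO Q) :
    qdet (g * h) = qdet g + qdet h := by
  set B := Q.polarBilin with hB
  have hsymm : ∀ x y, B x y = B y x := fun x y => QuadraticMap.polar_comm Q x y
  have hrefl : B.IsRefl := fun x y hxy => by rw [hsymm]; exact hxy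
  set dg : V →ₗ[F] V := LinearMap.id - (g : V →ₗ[F] V) with hdg
  set dh : V →ₗ[F] V := LinearMap.id - (h : V →ₗ[F] V) with hdh
  set dgh : V →ₗ[F] V := LinearMap.id - ((g * h : V ≃ₗ[F] V) : V →ₗ[F] V) with hdgh
  have edg : ∀ x, dg x = x - g x := fun x => rfl
  have edh : ∀ x, dh x = x - h x := fun x => rfl
  have edgh : ∀ x, dgh x = x - g (h x) := fun x => rfl
  have og : LinearMap.BilinForm.orthogonal B (LinearMap.range dg) = LinearMap.ker dg :=
    GO.orthogonal_fixed hQ hg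
  have oh : LinearMap.BilinForm.orthogonal B (LinearMap.range dh) = LinearMap.ker dh :=
    GO.orthogonal_fixed hQ hh
  set M : Submodule F V := LinearMap.range dg ⊓ LinearMap.range dh with hM
  have oM : LinearMap.BilinForm.orthogonal B M = LinearMap.ker dg ⊔ LinearMap.ker dh := by
    rw [← LinearMap.BilinForm.orthogonal_orthogonal hQ hrefl (LinearMap.ker dg ⊔ LinearMap.ker dh)]
    congr 1
    rw [hM, ← LinearMap.BilinForm.orthogonal_orthogonal hQ hrefl (LinearMap.range dg),
      ← LinearMap.BilinForm.orthogonal_orthogonal hQ hrefl (LinearMap.range dh), og, oh]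
    ext x
    simp only [Submodule.mem_inf, LinearMap.BilinForm.mem_orthogonal_iff, Submodule.mem_sup]
    constructor
    · rintro ⟨h1, h2⟩ _ ⟨y, hy, z, hz, rfl⟩
      rw [map_add, LinearMap.add_apply, h1 y hy, h2 z hz, add_zero]
    · intro h1
      exact ⟨fun y hy => h1 y ⟨y, hy, 0, Submodule.zero_mem _, add_zero y⟩,
        fun y hy => h1 y ⟨0, Submodule.zero_mem _, y, hy, zero_add y⟩⟩
  -- linear sections of `1 - g` and `1 - h` over `M`
  obtain ⟨p₀, hp₀⟩ := LinearMap.exists_rightInverse_of_surjective dg.rangeRestrict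
    dg.range_rangeRestrict
  obtain ⟨q₀, hq₀⟩ := LinearMap.exists_rightInverse_of_surjective dh.rangeRestrict
    dh.range_rangeRestrict
  let p : M →ₗ[F] V := p₀ ∘ₗ Submodule.inclusion inf_le_left
  let q : M →ₗ[F] V := q₀ ∘ₗ Submodule.inclusion inf_le_right
  have hp : ∀ m : M, p m - g (p m) = m := fun m => by
    have := congrArg Subtype.val (LinearMap.congr_fun hp₀ (Submodule.inclusion inf_le_left m))
    exact this
  have hq : ∀ m : M, q m - h (q m) = m := fun m => by
    have := congrArg Subtype.val (LinearMap.congr_fun hq₀ (Submodule.inclusion inf_le_right m))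
    exact this
  let a : M →ₗ[F] M →ₗ[F] F := B.compl₁₂ (p + (h : V →ₗ[F] V) ∘ₗ q) M.subtype
  have ha : ∀ m m' : M, a m m' = B (p m + h (q m)) m' := fun m m' => rfl
  have hiso : ∀ {k : V ≃ₗ[F] V}, k ∈ GO Q → ∀ x, Q (x - k x) = B x (x - k x) := by
    intro k hk x
    have hk' : Q (k x) = Q x := hk x
    have h1 : Q x = Q (x - k x) + Q (k x) + B (x - k x) (k x) := by
      conv_lhs => rw [← sub_add_cancel x (k x)]
      exact QuadraticMap.map_add Q _ _
    have h2 : B x x = 2 * Q x := by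
      rw [hB, QuadraticMap.polarBilin_apply_apply, QuadraticMap.polar_self]
      simp
    have h3 : B (k x) (k x) = 2 * Q x := by rw [GO.polar_map hk, h2]
    have h4 : B (k x) x = B x (k x) := hsymm _ _
    rw [hk'] at h1
    simp only [map_sub, LinearMap.sub_apply, h2, h3] at h1 ⊢
    linear_combination -h1
  have halt : ∀ m, a m m = 0 := by
    intro m
    have h1 := hiso hg (p m)
    have h2 := hiso hh (q m)
    rw [hp] at h1
    rw [hq] at h2
    have h3 : h (q m) = q m - m := by rw [← hq m]; abel
    have h4 : B (m : V) (m : V) = 2 * Q m := by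
      rw [hB, QuadraticMap.polarBilin_apply_apply, QuadraticMap.polar_self]
      simp
    rw [ha, h3, map_add, LinearMap.add_apply, map_sub, LinearMap.sub_apply, ← h1, ← h2, h4]
    ring
  have heven := even_finrank_of_alternating _ a halt rfl
  -- the map `1 - h` from the fixed space of `g * h` to `M`
  let φ : LinearMap.ker dgh →ₗ[F] M := LinearMap.codRestrict M (dh ∘ₗ (LinearMap.ker dgh).subtype)
    (by
      rintro ⟨x, hx⟩
      have hx' : x = g (h x) := sub_eq_zero.1 (LinearMap.mem_ker.1 hx)
      refine ⟨⟨-h x, ?_⟩, ⟨x, rfl⟩⟩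
      simp only [edg, LinearMap.comp_apply, Submodule.subtype_apply, edh, map_neg, ← hx']
      abel)
  have hφ : ∀ x, (φ x : V) = x - h x := fun x => rfl
  have hkerφ : (LinearMap.ker φ).map (LinearMap.ker dgh).subtype =
      LinearMap.ker dg ⊓ LinearMap.ker dh := by
    ext x
    simp only [Submodule.mem_map, LinearMap.mem_ker, Submodule.subtype_apply, Submodule.mem_inf,
      edg, edh, sub_eq_zero]
    constructor
    · rintro ⟨⟨y, hy⟩, h1, rfl⟩
      have hy' : y = g (h y) := sub_eq_zero.1 (LinearMap.mem_ker.1 hy)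
      have h2 : y = h y := sub_eq_zero.1 (by rw [← hφ ⟨y, hy⟩, h1]; rfl)
      refine ⟨?_, h2⟩
      rw [← h2] at hy'
      exact hy'
    · rintro ⟨h1, h2⟩
      refine ⟨⟨x, ?_⟩, ?_, rfl⟩
      · rw [LinearMap.mem_ker, edgh, ← h2, ← h1, sub_self]
      · apply Subtype.ext
        rw [hφ]
        simpa [sub_eq_zero] using h2
  have hrangeφ : LinearMap.range φ = LinearMap.ker a := by
    ext m
    have hmem : m ∈ LinearMap.ker a ↔ p m + h (q m) ∈ LinearMap.ker dg ⊔ LinearMap.ker dh := by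
      rw [← oM, LinearMap.BilinForm.mem_orthogonal_iff, LinearMap.mem_ker]
      constructor
      · intro h1 n hn
        rw [hsymm]
        exact LinearMap.congr_fun h1 ⟨n, hn⟩
      · intro h1
        ext n
        rw [ha, hsymm]
        exact h1 n n.2
    rw [hmem, Submodule.mem_sup]
    constructor
    · rintro ⟨⟨x, hx⟩, rfl⟩
      have hx' : x = g (h x) := sub_eq_zero.1 (LinearMap.mem_ker.1 hx)
      set m := φ ⟨x, hx⟩ with hm
      have hmx : (m : V) = x - h x := rfl
      refine ⟨p m + h x, ?_, h (q m) - h x, ?_, by abel⟩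
      · have h1 := hp m
        rw [LinearMap.mem_ker, edg, map_add, ← hx', ← sub_eq_zero.2 (h1.trans hmx)]
        abel
      · have h1 := hq m
        rw [hmx] at h1
        have h2 : h (q m) - h x = q m - x := by
          rw [sub_eq_sub_iff_add_eq_add] at h1 ⊢
          rw [add_comm, ← h1.symm, add_comm]
        rw [LinearMap.mem_ker, edh, h2, map_sub, h2, sub_self]
    · rintro ⟨k, hk, l, hl, hkl⟩
      have hk' : k = g k := sub_eq_zero.1 (LinearMap.mem_ker.1 hk)
      have hl' : l = h l := sub_eq_zero.1 (LinearMap.mem_ker.1 hl)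
      have h1 := hp m
      have h2 := hq m
      have h3 : h (q m - l) = k - p m := by
        rw [map_sub, ← hl', sub_eq_sub_iff_add_eq_add, add_comm, ← hkl]
      have h4 : q m - l = m + (k - p m) := by
        rw [← h3, map_sub, ← hl', ← h2]
        abel
      refine ⟨⟨q m - l, ?_⟩, ?_⟩
      · rw [LinearMap.mem_ker, edgh, h3, h4, map_sub, ← hk']
        rw [← h1]
        abel
      · apply Subtype.ext
        rw [hφ]
        simp only [h3]
        rw [h4]
        abel
  have d1 := LinearMap.finrank_range_add_finrank_ker dg
  have d2 := LinearMap.finrank_range_add_finrank_ker dh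
  have d3 := LinearMap.finrank_range_add_finrank_ker dgh
  have d4 := LinearMap.finrank_range_add_finrank_ker φ
  have d5 := Submodule.finrank_sup_add_finrank_inf_eq (LinearMap.ker dg) (LinearMap.ker dh)
  have d6 := LinearMap.BilinForm.finrank_orthogonal hQ M
  have d7 := Submodule.finrank_le M
  have d8 : Module.finrank F (LinearMap.ker φ) =
      Module.finrank F (LinearMap.ker dg ⊓ LinearMap.ker dh : Submodule F V) := by
    rw [← hkerφ, Submodule.finrank_map_subtype_eq]
  rw [oM] at d6
  rw [hrangeφ] at d4
  have hsum : Module.finrank F (LinearMap.range dgh) +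
      (Module.finrank F M + Module.finrank F (LinearMap.ker a)) =
      Module.finrank F (LinearMap.range dg) + Module.finrank F (LinearMap.range dh) := by
    omega
  have hcast := congrArg (Nat.cast (R := ZMod 2)) hsum
  rw [Nat.cast_add, (ZMod.natCast_eq_zero_iff_even).2 heven, add_zero, Nat.cast_add] at hcast
  exact hcast

theorem qdet_one {F V : Type*} [Field F] [AddCommGroup V] [Module F V] :
    qdet (1 : V ≃ₗ[F] V) = 0 := by
  have h : (LinearMap.id - ((1 : V ≃ₗ[F] V) : V →ₗ[F] V)) = 0 := sub_self _
  rw [qdet, h, LinearMap.range_zero, finrank_bot, Nat.cast_zero]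

/-- For a nonsingular form `Q`, the subgroup `SO(V, Q)` of `GO(V, Q)`: the kernel of the determinant
if `char F ≠ 2`, and the kernel of the quasideterminant if `char F = 2`. -/
def SO {F V : Type*} [Field F] [AddCommGroup V] [Module F V] [FiniteDimensional F V]
    (Q : QuadraticForm F V) (hQ : Q.polarBilin.Nondegenerate) : Subgroup (V ≃ₗ[F] V) where
  carrier := {g | g ∈ GO Q ∧ (ringChar F ≠ 2 → LinearEquiv.det g = 1) ∧
    (ringChar F = 2 → qdet g = 0)}
  mul_mem' {g h} hg hh := ⟨mul_mem hg.1 hh.1,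
    fun hF => by rw [map_mul, hg.2.1 hF, hh.2.1 hF, one_mul],
    fun hF => by rw [qdet_mul hQ hg.1 hh.1, hg.2.2 hF, hh.2.2 hF, add_zero]⟩
  one_mem' := ⟨one_mem _, fun _ => map_one _, fun _ => qdet_one⟩
  inv_mem' {g} hg := ⟨inv_mem hg.1, fun hF => by rw [map_inv, hg.2.1 hF, inv_one],
    fun hF => by
      have h := qdet_mul hQ hg.1 (inv_mem hg.1)
      rwa [mul_inv_cancel, qdet_one, hg.2.2 hF, zero_add, eq_comm] at h⟩

/-- `g` is induced by the even unit `x` of the Clifford algebra of `Q`, that is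
`x v x⁻¹ = g v` for all `v` in `V`, and the norm `xᵗ x` is the scalar `a`. The spinor norm of `g` is
then the class of `a` modulo the squares of `Fˣ`. (If `Q` is nonsingular on an even-dimensional space,
every element of `SO(V, Q)` is induced by an even unit, which is unique up to a scalar.) -/
def HasSpinorNorm {F V : Type*} [Field F] [AddCommGroup V] [Module F V]
    (Q : QuadraticForm F V) (g : V ≃ₗ[F] V) (a : Fˣ) : Prop :=
  ∃ x : (CliffordAlgebra Q)ˣ, (x : CliffordAlgebra Q) ∈ CliffordAlgebra.evenOdd Q 0 ∧
    (∀ v : V, (x : CliffordAlgebra Q) * CliffordAlgebra.ι Q v * (x⁻¹ : (CliffordAlgebra Q)ˣ) =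
      CliffordAlgebra.ι Q (g v)) ∧
    CliffordAlgebra.reverse (x : CliffordAlgebra Q) * x = algebraMap F (CliffordAlgebra Q) a

theorem HasSpinorNorm.one {F V : Type*} [Field F] [AddCommGroup V] [Module F V]
    (Q : QuadraticForm F V) : HasSpinorNorm Q 1 1 :=
  ⟨1, SetLike.GradedOne.one_mem, fun v => by simp, by simp⟩

theorem HasSpinorNorm.mul {F V : Type*} [Field F] [AddCommGroup V] [Module F V]
    {Q : QuadraticForm F V} {g h : V ≃ₗ[F] V} {a b : Fˣ} (hg : HasSpinorNorm Q g a)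
    (hh : HasSpinorNorm Q h b) : HasSpinorNorm Q (g * h) (a * b) := by
  obtain ⟨x, hx0, hx1, hx2⟩ := hg
  obtain ⟨y, hy0, hy1, hy2⟩ := hh
  refine ⟨x * y, ?_, fun v => ?_, ?_⟩
  · have := SetLike.GradedMul.mul_mem hx0 hy0
    simpa using this
  · rw [LinearEquiv.mul_apply, ← hx1, ← hy1, mul_inv_rev, Units.val_mul, Units.val_mul]
    simp only [mul_assoc]
  · rw [Units.val_mul, CliffordAlgebra.reverse.map_mul, mul_assoc,
      ← mul_assoc (CliffordAlgebra.reverse (x : CliffordAlgebra Q)), hx2, Units.val_mul, map_mul,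
      ← hy2, ← mul_assoc, ← mul_assoc, Algebra.commutes]

theorem HasSpinorNorm.inv {F V : Type*} [Field F] [AddCommGroup V] [Module F V]
    {Q : QuadraticForm F V} {g : V ≃ₗ[F] V} {a : Fˣ} (hg : HasSpinorNorm Q g a) :
    HasSpinorNorm Q g⁻¹ a⁻¹ := by
  obtain ⟨x, hx0, hx1, hx2⟩ := hg
  have hrev : CliffordAlgebra.reverse (x : CliffordAlgebra Q) =
      algebraMap F (CliffordAlgebra Q) a * (x⁻¹ : (CliffordAlgebra Q)ˣ) := by
    rw [← hx2, mul_assoc, Units.mul_inv, mul_one]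
  have hinv : ((x⁻¹ : (CliffordAlgebra Q)ˣ) : CliffordAlgebra Q) =
      (a⁻¹ : F) • CliffordAlgebra.reverse (x : CliffordAlgebra Q) := by
    rw [hrev, ← Algebra.smul_def, smul_smul, inv_mul_cancel₀ a.ne_zero, one_smul]
  refine ⟨x⁻¹, ?_, fun v => ?_, ?_⟩
  · rw [hinv]
    exact Submodule.smul_mem _ _ ((CliffordAlgebra.reverse_mem_evenOdd_iff Q).2 hx0)
  · have h := hx1 (g⁻¹ v)
    have hv : g (g⁻¹ v) = v := LinearEquiv.apply_symm_apply g v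
    rw [hv] at h
    rw [← h, inv_inv]
    simp only [mul_assoc, Units.inv_mul, mul_one]
    rw [← mul_assoc, Units.inv_mul, one_mul]
  · conv_lhs => rw [hinv, map_smul, CliffordAlgebra.reverse_reverse]
    rw [← hinv, smul_mul_assoc, Units.mul_inv, Algebra.algebraMap_eq_smul_one, Units.val_inv_eq_inv_val]

/-- The group `Ω(V, Q)` of a nonsingular form `Q` on an even-dimensional space: the kernel of the
spinor norm on `SO(V, Q)`, that is the elements of `SO(V, Q)` whose spinor norm is the class of the
squares. -/
def Omega {F V : Type*} [Field F] [AddCommGroup V] [Module F V] [FiniteDimensional F V]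
    (Q : QuadraticForm F V) (hQ : Q.polarBilin.Nondegenerate) : Subgroup (V ≃ₗ[F] V) where
  carrier := {g | g ∈ SO Q hQ ∧ ∃ c : Fˣ, HasSpinorNorm Q g (c ^ 2)}
  mul_mem' := by
    rintro g h ⟨hg, c, hc⟩ ⟨hh, d, hd⟩
    exact ⟨mul_mem hg hh, c * d, by rw [mul_pow]; exact hc.mul hd⟩
  one_mem' := ⟨one_mem _, 1, by rw [one_pow]; exact HasSpinorNorm.one Q⟩
  inv_mem' := by
    rintro g ⟨hg, c, hc⟩
    exact ⟨inv_mem hg, c⁻¹, by rw [inv_pow]; exact hc.inv⟩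

/-- The Witt index of `Q`: the largest dimension of a subspace on which `Q` vanishes identically. -/
noncomputable def wittIndex {F V : Type*} [Field F] [AddCommGroup V] [Module F V]
    (Q : QuadraticForm F V) : ℕ :=
  sSup {d | ∃ U : Submodule F V, (∀ u ∈ U, Q u = 0) ∧ Module.finrank F U = d}

/-- The natural action of `Ω(V, Q)` on the additive group of `V`. -/
def omegaAut {F V : Type*} [Field F] [AddCommGroup V] [Module F V] [FiniteDimensional F V]
    (Q : QuadraticForm F V) (hQ : Q.polarBilin.Nondegenerate) :
    Omega Q hQ →* MulAut (Multiplicative V) where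
  toFun g := AddEquiv.toMultiplicative (g : V ≃ₗ[F] V).toAddEquiv
  map_one' := rfl
  map_mul' _ _ := rfl

/-- The affine group `V:Ω(V, Q)`, the semidirect product for the natural action. -/
abbrev AffineOmega {F V : Type*} [Field F] [AddCommGroup V] [Module F V] [FiniteDimensional F V]
    (Q : QuadraticForm F V) (hQ : Q.polarBilin.Nondegenerate) : Type _ :=
  Multiplicative V ⋊[omegaAut Q hQ] Omega Q hQ

/-- The affine action of `V:Ω(V, Q)` on `V`: the pair `(v, A)` acts as `u ↦ A u + v`. -/
def affineAction {F V : Type*} [Field F] [AddCommGroup V] [Module F V] [FiniteDimensional F V]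
    (Q : QuadraticForm F V) (hQ : Q.polarBilin.Nondegenerate) :
    AffineOmega Q hQ →* Equiv.Perm V where
  toFun x := ((x.right : V ≃ₗ[F] V).toEquiv).trans (Equiv.addRight (Multiplicative.toAdd x.left))
  map_one' := by
    ext u
    simp
  map_mul' x y := by
    ext u
    change (x.right : V ≃ₗ[F] V) ((y.right : V ≃ₗ[F] V) u) +
        (Multiplicative.toAdd x.left + (x.right : V ≃ₗ[F] V) (Multiplicative.toAdd y.left)) =
      (x.right : V ≃ₗ[F] V) ((y.right : V ≃ₗ[F] V) u + Multiplicative.toAdd y.left) +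
        Multiplicative.toAdd x.left
    rw [map_add]
    abel

end Orth

/-! Both claims reduce to one fact, `eq_top_of_invariant`: a nonzero additive subgroup `A` of `V`
invariant under Ω is all of `V`. A subgroup strictly above Ω is determined by the translations it
contains, and a block through `0` is itself an additive subgroup; in both cases the resulting
subgroup of `V` is Ω-invariant.

The only elements of Ω needed are the Siegel transformations `1 + N`, with `u` singular and `w`
orthogonal to `u`. They lie in Ω in every characteristic (`siegel_mem_Omega`), and `N a` lies in `A`
whenever `a` does. Since `w` may be rescaled, this puts whole lines into `A`: by `smul_mem_of_pair`,
every singular line contained in a totally singular plane.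

Let `S` be the largest subspace inside `A`. Its orthogonal `P` is also Ω-invariant. If `P` were
nonzero, it would contain a singular vector `e` from a totally singular plane, while `S` contains a
singular `h` not orthogonal to `e`. So `P = 0` and `S = V`. -/

namespace Orth

/-! ### Siegel transformations and their membership in Ω. -/

section Siegel

variable {F V : Type*} [Field F] [AddCommGroup V] [Module F V]

/-- The nilpotent part `v ↦ B(w, v) u - B(u, v) w - Q(w) B(u, v) u` of a Siegel transformation,
where `B` is the polar form of `Q`. -/
noncomputable def siegelNilpotent (Q : QuadraticForm F V) (u w : V) : V →ₗ[F] V :=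
  (Q.polarBilin w).smulRight u - (Q.polarBilin u).smulRight w -
    (Q w • Q.polarBilin u).smulRight u

theorem siegelNilpotent_apply (Q : QuadraticForm F V) (u w v : V) :
    siegelNilpotent Q u w v =
      Q.polarBilin w v • u - Q.polarBilin u v • w - (Q w * Q.polarBilin u v) • u :=
  rfl

theorem polarBilin_symm (Q : QuadraticForm F V) (x y : V) :
    Q.polarBilin x y = Q.polarBilin y x :=
  QuadraticMap.polar_comm Q x y

theorem polarBilin_self (Q : QuadraticForm F V) (x : V) : Q.polarBilin x x = 2 * Q x := by
  rw [QuadraticMap.polarBilin_apply_apply, QuadraticMap.polar_self, nsmul_eq_mul, Nat.cast_ofNat]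

theorem map_add_polarBilin (Q : QuadraticForm F V) (x y : V) :
    Q (x + y) = Q x + Q y + Q.polarBilin x y :=
  QuadraticMap.map_add Q x y

variable {Q : QuadraticForm F V} {u w : V}

theorem polarBilin_siegelNilpotent (hu : Q u = 0) (huw : Q.polarBilin u w = 0) (v : V) :
    Q.polarBilin u (siegelNilpotent Q u w v) = 0 := by
  have huu : Q.polarBilin u u = 0 := by rw [polarBilin_self, hu, mul_zero]
  simp only [siegelNilpotent_apply, map_sub, map_smul, huu, huw, smul_zero, sub_zero]

theorem siegelNilpotent_siegelNilpotent (hu : Q u = 0) (huw : Q.polarBilin u w = 0) (v : V) :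
    siegelNilpotent Q u w (siegelNilpotent Q u w v) = -((2 * Q w * Q.polarBilin u v) • u) := by
  rw [siegelNilpotent_apply Q u w (siegelNilpotent Q u w v),
    polarBilin_siegelNilpotent hu huw, siegelNilpotent_apply]
  simp only [map_sub, map_smul, polarBilin_self, polarBilin_symm Q w u, huw, smul_eq_mul]
  module

theorem siegelNilpotent_self (hu : Q u = 0) (huw : Q.polarBilin u w = 0) :
    siegelNilpotent Q u w u = 0 := by
  simp only [siegelNilpotent_apply, polarBilin_self, polarBilin_symm Q w u, hu, huw]
  module

/-- With `N` the map in question, `N² v` depends only on `B(u, v)`, and the range of `N` is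
orthogonal to `u`; hence `N³ = 0`. -/
theorem isNilpotent_siegelNilpotent (hu : Q u = 0) (huw : Q.polarBilin u w = 0) :
    IsNilpotent (siegelNilpotent Q u w : Module.End F V) := by
  refine ⟨3, LinearMap.ext fun v => ?_⟩
  rw [pow_succ, pow_two, Module.End.mul_apply, Module.End.mul_apply,
    siegelNilpotent_siegelNilpotent hu huw, polarBilin_siegelNilpotent hu huw]
  simp

/-- For `u` singular and orthogonal to `w`, the last term is `N² v`, so replacing `w` by `-w` turns
`1 + N` into `1 - N + N²`, its inverse. -/
theorem siegelNilpotent_neg (v : V) :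
    siegelNilpotent Q u (-w) v =
      -siegelNilpotent Q u w v - (2 * Q w * Q.polarBilin u v) • u := by
  simp only [siegelNilpotent_apply, map_neg, LinearMap.neg_apply, QuadraticMap.map_neg]
  module

/-- The Siegel transformation attached to a singular vector `u` and a vector `w` orthogonal
to `u`. -/
noncomputable def siegel (hu : Q u = 0) (huw : Q.polarBilin u w = 0) : V ≃ₗ[F] V :=
  LinearEquiv.ofLinearMap (LinearMap.id + siegelNilpotent Q u w)
    (LinearMap.id + siegelNilpotent Q u (-w))
    (by
      ext v
      simp only [LinearMap.comp_apply, LinearMap.add_apply, LinearMap.id_apply, map_add,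
        siegelNilpotent_neg, map_sub, map_neg, map_smul, siegelNilpotent_siegelNilpotent hu huw,
        siegelNilpotent_self hu huw]
      module)
    (by
      ext v
      simp only [LinearMap.comp_apply, LinearMap.add_apply, LinearMap.id_apply, map_add,
        siegelNilpotent_neg, siegelNilpotent_siegelNilpotent hu huw,
        polarBilin_siegelNilpotent hu huw]
      module)

theorem siegel_apply (hu : Q u = 0) (huw : Q.polarBilin u w = 0) (v : V) :
    siegel hu huw v = v + siegelNilpotent Q u w v :=
  rfl

theorem siegel_mem_GO (hu : Q u = 0) (huw : Q.polarBilin u w = 0) : siegel hu huw ∈ GO Q := by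
  intro v
  -- As `u` is singular and orthogonal to `w`, only the `w`-component of `N v` contributes. The
  -- value cancels against `B(v, N v)`.
  have h : Q (siegelNilpotent Q u w v) = Q w * Q.polarBilin u v ^ 2 := by
    rw [show siegelNilpotent Q u w v =
      (Q.polarBilin w v - Q w * Q.polarBilin u v) • u + (-Q.polarBilin u v) • w by
        rw [siegelNilpotent_apply]; module, map_add_polarBilin]
    simp only [QuadraticMap.map_smul, map_smul, LinearMap.smul_apply, hu, huw, smul_eq_mul]
    ring
  rw [siegel_apply, map_add_polarBilin, h, siegelNilpotent_apply]
  simp only [map_sub, map_smul, polarBilin_symm Q v, smul_eq_mul, LinearMap.sub_apply,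
    LinearMap.smul_apply]
  ring

theorem det_siegel [FiniteDimensional F V] (hu : Q u = 0) (huw : Q.polarBilin u w = 0) :
    LinearEquiv.det (siegel hu huw) = 1 := by
  have h := (isNilpotent_siegelNilpotent hu huw).neg.charpoly_eq_X_pow_finrank
  -- The characteristic polynomial of `-N` is a power of `X`; its value at `1` is `det (1 + N)`.
  have h1 := LinearMap.eval_charpoly (-siegelNilpotent Q u w : Module.End F V) 1
  rw [h, Polynomial.eval_pow, Polynomial.eval_X, one_pow, map_one, sub_neg_eq_add] at h1
  apply Units.ext
  rw [LinearEquiv.coe_det, Units.val_one, h1]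
  rfl

theorem exists_polarBilin_ne_zero (hQ : Q.polarBilin.Nondegenerate) {x : V} (hx : x ≠ 0) :
    ∃ v, Q.polarBilin x v ≠ 0 := by
  by_contra! h
  exact hx (hQ.1 x h)

/-- A vector orthogonal to the hyperplane `e^⊥` is a multiple of `e`. -/
theorem exists_smul_eq_of_orthogonal (hQ : Q.polarBilin.Nondegenerate) {e x : V} (he : e ≠ 0)
    (h : ∀ v, Q.polarBilin e v = 0 → Q.polarBilin x v = 0) : ∃ c : F, c • e = x := by
  obtain ⟨v, hv⟩ := exists_polarBilin_ne_zero hQ he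
  refine ⟨Q.polarBilin x v / Q.polarBilin e v, ?_⟩
  rw [← sub_eq_zero]
  refine hQ.1 _ fun y => ?_
  -- Any `y` is moved into the hyperplane orthogonal to `e` by subtracting a multiple of `v`.
  have h1 := h (y - (Q.polarBilin e y / Q.polarBilin e v) • v) (by
    rw [map_sub, map_smul, smul_eq_mul, div_mul_cancel₀ _ hv, sub_self])
  rw [map_sub, map_smul, smul_eq_mul, sub_eq_zero] at h1
  rw [map_sub, map_smul, LinearMap.sub_apply, LinearMap.smul_apply, smul_eq_mul, h1]
  field_simp
  ring

/-- The range of `N` is zero when `u` and `w` are dependent and the plane they span otherwise, so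
its dimension is even. -/
theorem qdet_siegel [FiniteDimensional F V] (hQ : Q.polarBilin.Nondegenerate) (hu : Q u = 0)
    (huw : Q.polarBilin u w = 0) : qdet (siegel hu huw) = 0 := by
  have hN : LinearMap.id - ((siegel hu huw : V ≃ₗ[F] V) : V →ₗ[F] V) =
      -siegelNilpotent Q u w := by
    ext v
    rw [LinearMap.sub_apply, LinearEquiv.coe_coe, siegel_apply, LinearMap.id_apply,
      LinearMap.neg_apply]
    abel
  rw [qdet, hN, LinearMap.range_neg]
  by_cases hu0 : u = 0
  · have : siegelNilpotent Q u w = 0 := by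
      ext v
      simp [siegelNilpotent_apply, hu0, -QuadraticMap.polarBilin_apply_apply]
    rw [this, LinearMap.range_zero, finrank_bot, Nat.cast_zero]
  by_cases hw : ∃ c : F, c • u = w
  · obtain ⟨c, rfl⟩ := hw
    have : siegelNilpotent Q u (c • u) = 0 := by
      ext v
      simp only [siegelNilpotent_apply, map_smul, LinearMap.smul_apply, QuadraticMap.map_smul, hu,
        LinearMap.zero_apply, smul_eq_mul]
      module
    rw [this, LinearMap.range_zero, finrank_bot, Nat.cast_zero]
  · have hli : LinearIndependent F ![u, w] :=
      (LinearIndependent.pair_iff' hu0).2 fun c hc => hw ⟨c, hc⟩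
    obtain ⟨x, hx0, hx⟩ : ∃ x, Q.polarBilin u x = 0 ∧ Q.polarBilin w x ≠ 0 := by
      -- Such an `x` is sent by `N` to a nonzero multiple of `u`; then `N y`, with `y` not
      -- orthogonal to `u`, supplies `w`.
      by_contra! h
      exact hw (exists_smul_eq_of_orthogonal hQ hu0 h)
    obtain ⟨y, hy⟩ := exists_polarBilin_ne_zero hQ hu0
    have hur : u ∈ LinearMap.range (siegelNilpotent Q u w) := by
      refine ⟨(Q.polarBilin w x)⁻¹ • x, ?_⟩
      rw [map_smul, siegelNilpotent_apply, hx0, mul_zero, zero_smul, sub_zero, zero_smul, sub_zero,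
        smul_smul, inv_mul_cancel₀ hx, one_smul]
    have hwr : w ∈ LinearMap.range (siegelNilpotent Q u w) := by
      have h1 := sub_mem (Submodule.smul_mem _ (Q.polarBilin w y - Q w * Q.polarBilin u y) hur)
        (LinearMap.mem_range_self (siegelNilpotent Q u w) y)
      rw [siegelNilpotent_apply] at h1
      have h2 := Submodule.smul_mem _ (Q.polarBilin u y)⁻¹ h1
      convert h2 using 1
      rw [show (Q.polarBilin w y - Q w * Q.polarBilin u y) • u - (Q.polarBilin w y • u -
        Q.polarBilin u y • w - (Q w * Q.polarBilin u y) • u) = Q.polarBilin u y • w by module,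
        smul_smul, inv_mul_cancel₀ hy, one_smul]
    have hr : LinearMap.range (siegelNilpotent Q u w) = Submodule.span F (Set.range ![u, w]) := by
      apply le_antisymm
      · rintro _ ⟨v, rfl⟩
        have h1 : u ∈ Submodule.span F (Set.range ![u, w]) := Submodule.subset_span ⟨0, rfl⟩
        have h2 : w ∈ Submodule.span F (Set.range ![u, w]) := Submodule.subset_span ⟨1, rfl⟩
        rw [siegelNilpotent_apply]
        exact sub_mem (sub_mem (Submodule.smul_mem _ _ h1) (Submodule.smul_mem _ _ h2))
          (Submodule.smul_mem _ _ h1)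
      · rw [Submodule.span_le]
        rintro _ ⟨i, rfl⟩
        fin_cases i
        · exact hur
        · exact hwr
    rw [hr, finrank_span_eq_card hli, Fintype.card_fin]
    rfl

-- The conjugating unit is `1 + uw`. Since `u² = 0` and `wu = -uw`, the product `uw` squares to
-- zero, so the inverse is `1 - uw = 1 + wu`, which is also the reverse; the norm is therefore `1`.
open CliffordAlgebra in
theorem hasSpinorNorm_siegel (hu : Q u = 0) (huw : Q.polarBilin u w = 0) :
    HasSpinorNorm Q (siegel hu huw) 1 := by
  have huu : ι Q u * ι Q u = 0 := by rw [ι_sq_scalar, hu, map_zero]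
  have hww : ι Q w * ι Q w = algebraMap F _ (Q w) := ι_sq_scalar Q w
  have hwu : ι Q w * ι Q u = -(ι Q u * ι Q w) :=
    eq_neg_of_add_eq_zero_right ((ι_mul_ι_add_swap u w).trans (by
      rw [show QuadraticMap.polar Q u w = 0 from huw, map_zero]))
  have hsq : ι Q u * ι Q w * (ι Q u * ι Q w) = 0 := by
    rw [mul_assoc, ← mul_assoc (ι Q w), hwu, neg_mul, mul_neg, mul_assoc (ι Q u),
      ← mul_assoc (ι Q u) (ι Q u), huu, zero_mul, neg_zero]
  let x : (CliffordAlgebra Q)ˣ :=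
    { val := 1 + ι Q u * ι Q w
      inv := 1 - ι Q u * ι Q w
      val_inv := by rw [add_mul, one_mul, mul_sub, mul_one, hsq]; abel
      inv_val := by rw [sub_mul, one_mul, mul_add, mul_one, hsq]; abel }
  refine ⟨x, add_mem SetLike.GradedOne.one_mem (ι_mul_ι_mem_evenOdd_zero Q u w), fun v => ?_, ?_⟩
  · rw [Units.mul_inv_eq_iff_eq_mul]
    change (1 + ι Q u * ι Q w) * ι Q v = ι Q (siegel hu huw v) * (1 + ι Q u * ι Q w)
    have h1 : ι Q u * ι Q w * ι Q v = Q.polarBilin w v • ι Q u - Q.polarBilin u v • ι Q w +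
        ι Q v * (ι Q u * ι Q w) := by
      rw [mul_assoc, ι_mul_ι_comm w v, mul_sub, ← mul_assoc, ι_mul_ι_comm u v, sub_mul,
        ← Algebra.commutes, Algebra.algebraMap_eq_smul_one, Algebra.algebraMap_eq_smul_one,
        smul_one_mul, smul_one_mul, mul_assoc, QuadraticMap.polarBilin_apply_apply,
        QuadraticMap.polarBilin_apply_apply]
      abel
    have h2 : ι Q u * (ι Q u * ι Q w) = 0 := by rw [← mul_assoc, huu, zero_mul]
    have h3 : ι Q w * (ι Q u * ι Q w) = -(Q w • ι Q u) := by
      rw [← mul_assoc, hwu, neg_mul, mul_assoc, hww, ← Algebra.commutes, ← Algebra.smul_def]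
    rw [siegel_apply, siegelNilpotent_apply, add_mul, one_mul, h1, mul_add, mul_one]
    simp only [map_add, map_sub, map_smul, add_mul, sub_mul, smul_mul_assoc, h2, h3]
    module
  · change reverse (1 + ι Q u * ι Q w) * (1 + ι Q u * ι Q w) = _
    rw [map_add, reverse.map_one, reverse.map_mul, reverse_ι, reverse_ι, hwu, Units.val_one,
      map_one]
    rw [← sub_eq_add_neg]
    exact x.inv_val

theorem siegel_mem_Omega [FiniteDimensional F V] (hQ : Q.polarBilin.Nondegenerate) (hu : Q u = 0)
    (huw : Q.polarBilin u w = 0) : siegel hu huw ∈ Omega Q hQ :=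
  ⟨⟨siegel_mem_GO hu huw, fun _ => det_siegel hu huw, fun _ => qdet_siegel hQ hu huw⟩, 1, by
    rw [one_pow]; exact hasSpinorNorm_siegel hu huw⟩

end Siegel

/-! ### Additive subgroups invariant under Ω. -/

section Irreducible

variable {F V : Type*} [Field F] [AddCommGroup V] [Module F V] [FiniteDimensional F V]
  {Q : QuadraticForm F V}

theorem siegelNilpotent_mem {hQ : Q.polarBilin.Nondegenerate} {A : AddSubgroup V}
    (hA : ∀ g ∈ Omega Q hQ, ∀ a ∈ A, g a ∈ A) {u w a : V} (hu : Q u = 0)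
    (huw : Q.polarBilin u w = 0) (ha : a ∈ A) : siegelNilpotent Q u w a ∈ A := by
  have h := sub_mem (hA _ (siegel_mem_Omega hQ hu huw) a ha) ha
  rwa [siegel_apply, add_sub_cancel_left] at h

/-- For `a` orthogonal to `e`, `N a` is just `B(w, a) e`. As `a` is not a multiple of `e`, some `w`
orthogonal to `e` has `B(w, a) ≠ 0`, and rescaling `w` gives every multiple of `e`. -/
theorem smul_mem_of_orthogonal {hQ : Q.polarBilin.Nondegenerate} {A : AddSubgroup V}
    (hA : ∀ g ∈ Omega Q hQ, ∀ a ∈ A, g a ∈ A) {e a : V} (he : Q e = 0) (he0 : e ≠ 0)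
    (ha : a ∈ A) (hea : Q.polarBilin e a = 0) (hne : ∀ c : F, c • e ≠ a) (c : F) :
    c • e ∈ A := by
  obtain ⟨w, hw0, hw⟩ : ∃ w, Q.polarBilin e w = 0 ∧ Q.polarBilin a w ≠ 0 := by
    by_contra! h
    obtain ⟨c, hc⟩ := exists_smul_eq_of_orthogonal hQ he0 h
    exact hne c hc
  have h := siegelNilpotent_mem hA (w := (c / Q.polarBilin a w) • w) he
    (by rw [map_smul, hw0, smul_zero]) ha
  rwa [siegelNilpotent_apply, hea, zero_smul, sub_zero, mul_zero, zero_smul, sub_zero, map_smul,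
    LinearMap.smul_apply, smul_eq_mul, polarBilin_symm Q w a, div_mul_cancel₀ _ hw] at h

/-- A nonzero additive subgroup invariant under `Ω(V, Q)` contains every line that lies in a totally
singular plane. -/
theorem smul_mem_of_pair {hQ : Q.polarBilin.Nondegenerate} {A : AddSubgroup V}
    (hA : ∀ g ∈ Omega Q hQ, ∀ a ∈ A, g a ∈ A) {a : V} (ha : a ∈ A) (ha0 : a ≠ 0) {e f : V}
    (hli : LinearIndependent F ![e, f]) (he : Q e = 0) (hf : Q f = 0)
    (hef : Q.polarBilin e f = 0) (c : F) : c • e ∈ A := by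
  have he0 : e ≠ 0 := hli.ne_zero 0
  have hf0 : f ≠ 0 := hli.ne_zero 1
  have hpair := LinearIndependent.pair_iff.1 hli
  have hee : Q.polarBilin e e = 0 := by rw [polarBilin_self, he, mul_zero]
  by_cases hea : Q.polarBilin e a = 0
  · by_cases hne : ∃ d : F, d • e = a
    · obtain ⟨d, rfl⟩ := hne
      have hd : d ≠ 0 := fun h => ha0 (by rw [h, zero_smul])
      -- Here `a` lies on the line of `e`, so the previous lemma does not apply to `e` directly; it
      -- gives `f` first, and then `f` serves in place of `a`.
      have hfA : f ∈ A := by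
        have h := smul_mem_of_orthogonal hA hf hf0 ha
          (by rw [map_smul, polarBilin_symm, hef, smul_zero])
          (fun t ht => hd (hpair d (-t) (by rw [← ht]; module)).1) 1
        rwa [one_smul] at h
      exact smul_mem_of_orthogonal hA he he0 hfA hef
        (fun t ht => one_ne_zero (α := F) (hpair (-t) 1 (by rw [← ht]; module)).2) c
    · exact smul_mem_of_orthogonal hA he he0 ha hea (fun t ht => hne ⟨t, ht⟩) c
  -- The vector `N a = B(f, a) e - B(e, a) f` is in `A`, is orthogonal to `e`, and is not a multiple
  -- of `e` because `B(e, a) ≠ 0`.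
  · have h := siegelNilpotent_mem hA he hef ha
    refine smul_mem_of_orthogonal hA he he0 h (polarBilin_siegelNilpotent he hef a) ?_ c
    intro t ht
    rw [siegelNilpotent_apply, hf, zero_mul, zero_smul, sub_zero] at ht
    exact hea (hpair (t - Q.polarBilin f a) (Q.polarBilin e a) (by
      rw [sub_smul, ht]; module)).2

theorem exists_pair_of_two_le_wittIndex (h : 2 ≤ wittIndex Q) :
    ∃ e f : V, LinearIndependent F ![e, f] ∧ Q e = 0 ∧ Q f = 0 ∧ Q.polarBilin e f = 0 := by
  -- The supremum is attained: the set of dimensions contains `0` and is bounded by `dim V`.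
  have hmem := Nat.sSup_mem
    (s := {d | ∃ U : Submodule F V, (∀ u ∈ U, Q u = 0) ∧ Module.finrank F U = d})
    ⟨0, ⊥, fun u hu => by rw [(Submodule.mem_bot F).1 hu, QuadraticMap.map_zero], finrank_bot F V⟩
    ⟨Module.finrank F V, by rintro _ ⟨U, -, rfl⟩; exact U.finrank_le⟩
  obtain ⟨U, hU, hd⟩ := hmem
  have h1 : 1 < Module.finrank F U := by rw [hd]; exact h
  have : Nontrivial U := Module.nontrivial_of_finrank_pos (zero_lt_one.trans h1)
  obtain ⟨x, hx⟩ := exists_ne (0 : U)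
  obtain ⟨y, hxy⟩ := exists_linearIndependent_pair_of_one_lt_finrank h1 hx
  refine ⟨x, y, ?_, hU x x.2, hU y y.2, ?_⟩
  · rw [LinearIndependent.pair_iff] at hxy ⊢
    exact fun s t hst => hxy s t (Subtype.ext hst)
  · have h2 := map_add_polarBilin Q (x : V) y
    rw [hU _ (add_mem x.2 y.2), hU x x.2, hU y y.2, zero_add, zero_add] at h2
    exact h2.symm

/-- If the Witt index of `Q` is at least `2`, then `V` has no proper nonzero additive subgroup
invariant under `Ω(V, Q)`. -/
theorem eq_top_of_invariant (hQ : Q.polarBilin.Nondegenerate) (hW : 2 ≤ wittIndex Q)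
    {A : AddSubgroup V} (hA : ∀ g ∈ Omega Q hQ, ∀ a ∈ A, g a ∈ A) (hA0 : A ≠ ⊥) : A = ⊤ := by
  obtain ⟨⟨a, ha⟩, hne⟩ := AddSubgroup.ne_bot_iff_exists_ne_zero.1 hA0
  have ha0 : a ≠ 0 := fun h0 => hne (Subtype.ext h0)
  obtain ⟨e, f, hli, he, hf, hef⟩ := exists_pair_of_two_le_wittIndex hW
  have hpair := LinearIndependent.pair_iff.1 hli
  have hee : Q.polarBilin e e = 0 := by rw [polarBilin_self, he, mul_zero]
  -- The largest subspace contained in `A`; passing to it makes orthogonal complements available.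
  let S : Submodule F V :=
    { carrier := {x | ∀ c : F, c • x ∈ A}
      add_mem' := fun hx hy c => by rw [smul_add]; exact add_mem (hx c) (hy c)
      zero_mem' := fun c => by rw [smul_zero]; exact zero_mem A
      smul_mem' := fun c x hx d => by rw [smul_smul]; exact hx _ }
  suffices hS : S = ⊤ by
    refine eq_top_iff.2 fun x _ => ?_
    have h : x ∈ S := hS ▸ Submodule.mem_top
    simpa using h 1
  set P := LinearMap.BilinForm.orthogonal Q.polarBilin S with hP
  have hmemP : ∀ x, x ∈ P ↔ ∀ y ∈ S, Q.polarBilin y x = 0 := fun x =>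
    LinearMap.BilinForm.mem_orthogonal_iff
  have hPinv : ∀ g ∈ Omega Q hQ, ∀ x ∈ P.toAddSubgroup, g x ∈ P.toAddSubgroup := by
    intro g hg x hx
    refine (hmemP _).2 fun y hy => ?_
    have hg' : g⁻¹ ∈ Omega Q hQ := inv_mem hg
    have h1 : g⁻¹ y ∈ S := fun c => by rw [← map_smul]; exact hA _ hg' _ (hy c)
    have h2 : g (g⁻¹ y) = y := LinearEquiv.apply_symm_apply g y
    rw [← h2, GO.polar_map hg.1.1]
    exact (hmemP x).1 hx _ h1
  have hPbot : P = ⊥ := by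
    by_contra hne
    obtain ⟨p, hp, hp0⟩ := P.ne_bot_iff.1 hne
    have heP : e ∈ P := by
      have h := smul_mem_of_pair hPinv hp hp0 hli he hf hef 1
      rwa [one_smul] at h
    have he0 : e ≠ 0 := hli.ne_zero 0
    obtain ⟨v, hv⟩ := exists_polarBilin_ne_zero hQ he0
    -- The multiple of `e` is chosen to make `h` singular, keeping `B(e, h) = B(e, v) ≠ 0`.
    set h := v - (Q v / Q.polarBilin e v) • e with hh
    have heh : Q.polarBilin e h = Q.polarBilin e v := by
      rw [hh, map_sub, map_smul, hee, smul_zero, sub_zero]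
    have hQh : Q h = 0 := by
      rw [hh, sub_eq_add_neg, ← neg_smul, map_add_polarBilin, QuadraticMap.map_smul, he, map_smul,
        polarBilin_symm Q v e, smul_eq_mul, smul_eq_mul, neg_mul _ (Q.polarBilin e v),
        div_mul_cancel₀ _ hv]
      ring
    -- Correcting `f` along `e` makes `k` orthogonal to `h`, so `h` and `k` span a totally singular
    -- plane and `h` falls into `S`.
    set k := f - (Q.polarBilin h f / Q.polarBilin e v) • e with hk
    have hQk : Q k = 0 := by
      rw [hk, sub_eq_add_neg, ← neg_smul, map_add_polarBilin, QuadraticMap.map_smul, he, map_smul,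
        polarBilin_symm Q f e, hef, hf]
      simp
    have hhk : Q.polarBilin h k = 0 := by
      rw [hk, map_sub, map_smul, polarBilin_symm Q h e, heh, smul_eq_mul, div_mul_cancel₀ _ hv,
        sub_self]
    have hek : Q.polarBilin e k = 0 := by
      rw [hk, map_sub, map_smul, hee, hef, smul_zero, sub_zero]
    have hlihk : LinearIndependent F ![h, k] := by
      refine LinearIndependent.pair_iff.2 fun s t hst => ?_
      have h1 := congrArg (Q.polarBilin e) hst
      rw [map_add, map_smul, map_smul, hek, heh, smul_zero, add_zero, map_zero, smul_eq_mul,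
        mul_eq_zero, or_iff_left hv] at h1
      refine ⟨h1, ?_⟩
      rw [h1, zero_smul, zero_add, hk] at hst
      exact (hpair (-(t * (Q.polarBilin h f / Q.polarBilin e v))) t (by rw [← hst]; module)).2
    have hhS : h ∈ S := fun c => smul_mem_of_pair hA ha ha0 hlihk hQh hQk hhk c
    have := (hmemP e).1 heP h hhS
    rw [polarBilin_symm, heh] at this
    exact hv this
  have hrefl : Q.polarBilin.IsRefl := fun x y hxy => by rw [polarBilin_symm]; exact hxy
  rw [← LinearMap.BilinForm.orthogonal_orthogonal hQ hrefl S, ← hP, hPbot]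
  exact eq_top_iff.2 fun x _ => LinearMap.BilinForm.mem_orthogonal_iff.2 fun y hy => by
    rw [(Submodule.mem_bot F).1 hy]
    exact LinearMap.congr_fun (map_zero Q.polarBilin) x

/-! ### Maximality of Ω and primitivity of the affine action. -/

theorem isCoatom_range_inr (hQ : Q.polarBilin.Nondegenerate) (hW : 2 ≤ wittIndex Q) :
    IsCoatom (SemidirectProduct.inr : Omega Q hQ →* AffineOmega Q hQ).range := by
  obtain ⟨e, f, hli, -⟩ := exists_pair_of_two_le_wittIndex hW
  constructor
  · intro h
    obtain ⟨g, hg⟩ : (SemidirectProduct.inl (Multiplicative.ofAdd e) : AffineOmega Q hQ) ∈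
      (SemidirectProduct.inr : Omega Q hQ →* AffineOmega Q hQ).range := h ▸ Subgroup.mem_top _
    have h1 := congrArg (fun x => Multiplicative.toAdd x.left) hg
    exact (hli.ne_zero 0 : e ≠ 0) h1.symm
  · intro H hH
    obtain ⟨hle, x, hxH, hx⟩ := SetLike.lt_iff_le_and_exists.1 hH
    have hinr : ∀ g : Omega Q hQ, (SemidirectProduct.inr g : AffineOmega Q hQ) ∈ H :=
      fun g => hle ⟨g, rfl⟩
    -- Since `H` contains Ω, membership in `H` depends only on the translation part.
    have hleft : ∀ y : AffineOmega Q hQ, y ∈ H ↔ SemidirectProduct.inl y.left ∈ H := fun y => by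
      conv_lhs => rw [← SemidirectProduct.inl_left_mul_inr_right y]
      exact H.mul_mem_cancel_right (hinr _)
    let A : AddSubgroup V := Subgroup.toAddSubgroup' (H.comap SemidirectProduct.inl)
    have hmem : ∀ v : V, v ∈ A ↔
      (SemidirectProduct.inl (Multiplicative.ofAdd v) : AffineOmega Q hQ) ∈ H := fun v => Iff.rfl
    have hA : ∀ g ∈ Omega Q hQ, ∀ a ∈ A, g a ∈ A := by
      intro g hg a ha
      -- Conjugating the translation by `a` with `g` gives the translation by `g a`.
      have h := mul_mem (mul_mem (hinr ⟨g, hg⟩) ((hmem a).1 ha)) (inv_mem (hinr ⟨g, hg⟩))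
      rw [← map_inv, ← SemidirectProduct.inl_aut] at h
      exact h
    have hA0 : A ≠ ⊥ := by
      intro h0
      have h1 : Multiplicative.toAdd x.left ∈ A := (hleft x).1 hxH
      rw [h0, AddSubgroup.mem_bot] at h1
      refine hx ⟨x.right, SemidirectProduct.ext ?_ rfl⟩
      exact h1.symm
    have htop := eq_top_of_invariant hQ hW hA hA0
    refine eq_top_iff.2 fun y _ => (hleft y).2 ?_
    have : Multiplicative.toAdd y.left ∈ A := htop ▸ AddSubgroup.mem_top _
    exact this

theorem isPreprimitive_range_affineAction (hQ : Q.polarBilin.Nondegenerate)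
    (hW : 2 ≤ wittIndex Q) : MulAction.IsPreprimitive (affineAction Q hQ).range V := by
  let t (v : V) (g : Omega Q hQ) : (affineAction Q hQ).range :=
    ⟨affineAction Q hQ ⟨Multiplicative.ofAdd v, g⟩, _, rfl⟩
  have ht : ∀ v g u, t v g • u = (g : V ≃ₗ[F] V) u + v := fun _ _ _ => rfl
  have : MulAction.IsPretransitive (affineAction Q hQ).range V :=
    ⟨fun x y => ⟨t (y - x) 1, by rw [ht]; exact add_sub_cancel x y⟩⟩
  refine MulAction.IsPreprimitive.of_isTrivialBlock_base (0 : V) fun {D} h0 hD => ?_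
  -- The affine map `t v g` sends `0` to `v`; when both lie in the block `D`, it maps `D` onto
  -- itself. Taking `g = 1` gives closure under addition and negation, and `v = 0` gives invariance
  -- under Ω.
  have hfix : ∀ v ∈ D, ∀ g : Omega Q hQ, ∀ u, (g : V ≃ₗ[F] V) u + v ∈ D ↔ u ∈ D := by
    intro v hv g u
    have h := hD.smul_eq_of_mem (g := t v g) h0 (by rwa [ht, map_zero, zero_add])
    conv_lhs => rw [← ht, ← h]
    exact Set.smul_mem_smul_set_iff
  let A : AddSubgroup V :=
    { carrier := D
      add_mem' := fun {a b} ha hb => (hfix b hb 1 a).2 ha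
      zero_mem' := h0
      neg_mem' := fun {a} ha => (hfix a ha 1 (-a)).1 (by
        change -a + a ∈ D
        rwa [neg_add_cancel]) }
  have hA : ∀ g ∈ Omega Q hQ, ∀ a ∈ A, g a ∈ A := fun g hg a ha => by
    have h := (hfix 0 h0 ⟨g, hg⟩ a).2 ha
    rwa [add_zero] at h
  by_cases hA0 : A = ⊥
  · left
    intro x hx y hy
    have hx' : x ∈ A := hx
    have hy' : y ∈ A := hy
    rw [hA0, AddSubgroup.mem_bot] at hx' hy'
    rw [hx', hy']
  · right
    have htop := eq_top_of_invariant hQ hW hA hA0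
    exact Set.eq_univ_of_forall fun x => (htop ▸ AddSubgroup.mem_top x : x ∈ A)

end Irreducible

end Orth

theorem mainTheorem8 {F : Type*} [Field F] {W : Type*} [AddCommGroup W] [Module F W]
    [FiniteDimensional F W] (m : ℕ) (hdim : Module.finrank F W = 2 * m)
    (Q : QuadraticForm F W) (hQ : Q.polarBilin.Nondegenerate) (hW : 2 ≤ Orth.wittIndex Q) :
    IsCoatom (SemidirectProduct.inr : Orth.Omega Q hQ →* Orth.AffineOmega Q hQ).range ∧
      MulAction.IsPreprimitive (Orth.affineAction Q hQ).range W :=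
  ⟨Orth.isCoatom_range_inr hQ hW, Orth.isPreprimitive_range_affineAction hQ hW⟩
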